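/- Let $\mathbf{k}$ be a field or the ring $\mathbb{Z}$, let $m\ge 0$, and let $K$ be a simplicial complex on the set $[m]=\{1,\dots,m\}$, that is, a family of subsets of $[m]$ which contains $\varnothing$ and is closed under taking subsets (elements of $[m]$ need not be vertices of $K$). A missing face of $K$ is a subset $\tau\subseteq[m]$ with $\tau\notin K$ all of whose proper subsets belong to $K$. Let $\mathbb{P}$ be a simplicial complement of $K$, i.e. a set of subsets $\tau\subseteq[m]$ with $\tau\notin K$ that contains all missing faces of $K$. Let $\Lambda^*[\mathbb{P}]$ be the exterior algebra over $\mathbf{k}$ generated by the elements of $\mathbb{P}$. For a monomial $\mathbf{u}=\tau_{1}\cdots\tau_{n}$ with $\tau_1,\dots,\tau_n\in\mathbb{P}$ let $S_{\mathbf{u}}=\tau_1\cup\dots\cup\tau_n$, and for $i\ge 0$ and $J\subseteq[m]$ let $\Lambda^{i,J}[\mathbb{P}]$ be the submodule generated by the monomials $\mathbf{u}$ of degree $i$ with $S_{\mathbf{u}}=J$. Let $d$ be the $\mathbf{k}$-linear map given on monomials by $$d(\mathbf{u})=\sum_{j=1}^n(-1)^{j+1}\,\delta_j\,\partial_j\mathbf{u},\qquad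 \partial_j\mathbf{u}=\tau_1\cdots\widehat{\tau_j}\cdots\tau_n,$$ where $\delta_j=1$ if $S_{\partial_j\mathbf{u}}=S_{\mathbf{u}}$ and $\delta_j=0$ otherwise. Then $d$ maps $\Lambda^{i+1,J}[\mathbb{P}]$ into $\Lambda^{i,J}[\mathbb{P}]$ and $d^2=0$, so $(\Lambda^{*,J}[\mathbb{P}],d)$ is a chain complex for every $J\subseteq[m]$. Then for every $i\ge 0$ there is an isomorphism of $\mathbf{k}$-modules $$H_i\big(\Lambda^{*,[m]}[\mathbb{P}],d\big)\cong\widetilde{H}^{\,m-i-1}(K;\mathbf{k}),$$ where $\widetilde{H}^*(K;\mathbf{k})$ denotes the reduced simplicial cohomology of $K$, defined in all integer degrees, with the empty set as the unique simplex of dimension $-1$ (so $\widetilde H^{-1}(\{\varnothing\};\mathbf{k})=\mathbf{k}$). -/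

import Mathlib

open CategoryTheory

namespace SimplicialComplement

noncomputable section

/-! ### Simplices, missing faces and simplicial complements

A simplicial complex on the set `[m]` is a `PreAbstractSimplicialComplex (Fin m)`: not every
element of `[m]` has to be a vertex. Mathlib's `faces` are the nonempty simplices, and the empty
set is a simplex of every simplicial complex. -/

/-- `σ` is a simplex of `K`, where the empty set counts as a simplex. -/
def IsSimplex {m : ℕ} (K : PreAbstractSimplicialComplex (Fin m)) (σ : Finset (Fin m)) : Prop :=
  σ = ∅ ∨ σ ∈ K

theorem IsSimplex.mono {m : ℕ} {K : PreAbstractSimplicialComplex (Fin m)}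
    {σ τ : Finset (Fin m)} (hσ : IsSimplex K σ) (h : τ ⊆ σ) : IsSimplex K τ := by
  rcases τ.eq_empty_or_nonempty with h0 | h0
  · exact Or.inl h0
  · rcases hσ with rfl | hσ
    · exact Or.inl (Finset.subset_empty.mp h)
    · exact Or.inr ((K.isRelLowerSet_faces hσ).2 h h0)

/-- The set of missing faces of `K`: the non-simplices all of whose proper subsets are simplices. -/
def missingFaces {m : ℕ} (K : PreAbstractSimplicialComplex (Fin m)) : Set (Finset (Fin m)) :=
  {τ | ¬ IsSimplex K τ ∧ ∀ σ, σ ⊂ τ → IsSimplex K σ}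

/-- A simplicial complement of `K`: a set of non-simplices that contains all missing faces. -/
def IsSimplicialComplement {m : ℕ} (K : PreAbstractSimplicialComplex (Fin m))
    (P : Set (Finset (Fin m))) : Prop :=
  P ⊆ {τ | ¬ IsSimplex K τ} ∧ missingFaces K ⊆ P

/-! ### The exterior algebra on `P` with its bigrading and differential -/

/-- The exterior algebra over `k` generated by the elements of `P`. -/
abbrev Lam (k : Type*) [CommRing k] {m : ℕ} (P : Set (Finset (Fin m))) : Type _ :=
  ExteriorAlgebra k (P →₀ k)

/-- The monomial `τ₀ τ₁ ⋯ τₙ₋₁` in the exterior algebra. -/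
def monomial (k : Type*) [CommRing k] {m : ℕ} {P : Set (Finset (Fin m))} {n : ℕ}
    (τ : Fin n → P) : Lam k P :=
  ExteriorAlgebra.ιMulti k n fun j => Finsupp.single (τ j) (1 : k)

/-- The total set of a monomial: the union of its factors. -/
def totalSet {m : ℕ} {P : Set (Finset (Fin m))} {n : ℕ} (τ : Fin n → P) : Finset (Fin m) :=
  Finset.univ.biUnion fun j => (τ j : Finset (Fin m))

/-- The bigraded piece generated by the monomials of degree `i` with total set `J`. -/
def bigraded (k : Type*) [CommRing k] {m : ℕ} (P : Set (Finset (Fin m))) (i : ℕ)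
    (J : Finset (Fin m)) : Submodule k (Lam k P) :=
  Submodule.span k {u | ∃ τ : Fin i → P, totalSet τ = J ∧ u = monomial k τ}

section Construction

variable (k : Type*) [CommRing k] {m : ℕ} (P : Set (Finset (Fin m)))

theorem lam_ext {N : Type*} [AddCommGroup N] [Module k N] {f g : Lam k P →ₗ[k] N}
    (h : ∀ (n : ℕ) (τ : Fin n → P), f (monomial k τ) = g (monomial k τ)) : f = g := by
  apply ExteriorAlgebra.lhom_ext
  intro n
  apply Module.Basis.ext_alternating (Finsupp.basisSingleOne (R := k) (ι := P))
  intro v _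
  simpa [monomial] using h n v

/-- The sum of all contractions, without the condition on total sets. -/
def contraction : Lam k P →ₗ[k] Lam k P :=
  CliffordAlgebra.contractLeft (Q := (0 : QuadraticForm k (P →₀ k)))
    (Finsupp.lsum k fun _ : P => (LinearMap.id : k →ₗ[k] k))

theorem contraction_monomial {n : ℕ} (τ : Fin n.succ → P) :
    contraction k P (monomial k τ) =
      ∑ j : Fin n.succ, (-1 : k) ^ (j : ℕ) • monomial k fun l => τ (j.succAbove l) := by
  induction n with
  | zero =>
    rw [monomial, ExteriorAlgebra.ιMulti_succ_apply, contraction]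
    erw [CliffordAlgebra.contractLeft_ι_mul]
    simp [monomial, ExteriorAlgebra.ιMulti_zero_apply]
  | succ n ih =>
    have h1 : monomial k τ = ExteriorAlgebra.ι k (Finsupp.single (τ 0) 1) *
        monomial k (fun l => τ l.succ) := by
      rw [monomial, ExteriorAlgebra.ιMulti_succ_apply]; rfl
    rw [h1, contraction]
    erw [CliffordAlgebra.contractLeft_ι_mul]
    erw [ih]
    conv_rhs => rw [Fin.sum_univ_succ]
    rw [Finset.mul_sum, sub_eq_add_neg, ← Finset.sum_neg_distrib]
    congr 1
    · simp
    · refine Finset.sum_congr rfl fun j _ => ?_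
      have h2 : (monomial k fun l => τ (j.succ.succAbove l)) =
          ExteriorAlgebra.ι k (Finsupp.single (τ 0) 1) *
            monomial k (fun l => τ (j.succAbove l).succ) := by
        rw [monomial, ExteriorAlgebra.ιMulti_succ_apply]
        simp [monomial, Matrix.vecTail, Function.comp_def]
      rw [h2, Algebra.mul_smul_comm]
      simp [pow_succ]

theorem contraction_monomial_zero (τ : Fin 0 → P) : contraction k P (monomial k τ) = 0 := by
  rw [monomial, ExteriorAlgebra.ιMulti_zero_apply, contraction]
  exact CliffordAlgebra.contractLeft_one (Q := (0 : QuadraticForm k (P →₀ k))) _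

theorem contraction_contraction (x : Lam k P) : contraction k P (contraction k P x) = 0 :=
  CliffordAlgebra.contractLeft_contractLeft _ _

/-- The algebra map that kills the generators not contained in `J`. -/
def restrict (J : Finset (Fin m)) : Lam k P →ₗ[k] Lam k P :=
  (ExteriorAlgebra.map (Finsupp.lsum k fun τ : P =>
    (if (τ : Finset (Fin m)) ⊆ J then Finsupp.lsingle τ else 0 : k →ₗ[k] P →₀ k))).toLinearMap

theorem restrict_monomial (J : Finset (Fin m)) {n : ℕ} (τ : Fin n → P) :
    restrict k P J (monomial k τ) = if totalSet τ ⊆ J then monomial k τ else 0 := by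
  have h : totalSet τ ⊆ J ↔ ∀ j, (τ j : Finset (Fin m)) ⊆ J := by
    simp [totalSet]
  simp only [restrict, monomial, AlgHom.toLinearMap_apply, ExteriorAlgebra.map_apply_ιMulti]
  split_ifs with hJ
  · congr 1
    funext j
    simp [h.mp hJ j]
  · rw [h] at hJ
    push Not at hJ
    obtain ⟨j, hj⟩ := hJ
    apply AlternatingMap.map_coord_zero _ j
    simp [hj]

/-- The projection onto the span of the monomials with total set `J`. -/
def proj (J : Finset (Fin m)) : Lam k P →ₗ[k] Lam k P :=
  ∑ A ∈ J.powerset, (-1 : k) ^ A.card • restrict k P (J \ A)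

theorem proj_monomial (J : Finset (Fin m)) {n : ℕ} (τ : Fin n → P) :
    proj k P J (monomial k τ) = if totalSet τ = J then monomial k τ else 0 := by
  simp only [proj, LinearMap.sum_apply, LinearMap.smul_apply, restrict_monomial, smul_ite,
    smul_zero]
  by_cases hT : totalSet τ ⊆ J
  · have hf : J.powerset.filter (fun A => totalSet τ ⊆ J \ A) = (J \ totalSet τ).powerset := by
      ext A
      simp only [Finset.mem_filter, Finset.mem_powerset, Finset.subset_sdiff]
      constructor
      · rintro ⟨h1, _, h2⟩; exact ⟨h1, h2.symm⟩
      · rintro ⟨h1, h2⟩; exact ⟨h1, hT, h2.symm⟩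
    rw [← Finset.sum_filter, hf, ← Finset.sum_smul]
    have := Finset.sum_powerset_neg_one_pow_card (x := J \ totalSet τ)
    have h2 := congrArg (Int.cast : ℤ → k) this
    push_cast at h2
    rw [h2]
    have : J \ totalSet τ = ∅ ↔ totalSet τ = J := by
      rw [Finset.sdiff_eq_empty_iff_subset]
      exact ⟨fun h => hT.antisymm h, fun h => h.ge⟩
    simp only [this, ite_smul, one_smul, zero_smul]
  · rw [if_neg (fun h => hT h.le)]
    refine Finset.sum_eq_zero fun A _ => if_neg fun h => hT (h.trans Finset.sdiff_subset)

theorem totalSet_succAbove_subset {n : ℕ} (τ : Fin n.succ → P) (j : Fin n.succ) :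
    totalSet (fun l => τ (j.succAbove l)) ⊆ totalSet τ := by
  intro x
  simp only [totalSet, Finset.mem_biUnion, Finset.mem_univ, true_and]
  rintro ⟨l, hl⟩
  exact ⟨_, hl⟩

theorem exists_differential : ∃ d : Lam k P →ₗ[k] Lam k P,
    (∀ τ : Fin 0 → P, d (monomial k τ) = 0) ∧
    ∀ (n : ℕ) (τ : Fin (n + 1) → P), d (monomial k τ) =
      ∑ j : Fin (n + 1), (-1 : k) ^ (j : ℕ) •
        if totalSet τ = totalSet (fun l => τ (j.succAbove l))
          then monomial k (fun l => τ (j.succAbove l)) else 0 := by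
  refine ⟨∑ J : Finset (Fin m), proj k P J ∘ₗ contraction k P ∘ₗ proj k P J, ?_, ?_⟩
  · intro τ
    simp only [LinearMap.sum_apply, LinearMap.comp_apply, proj_monomial, apply_ite (contraction k P),
      map_zero, contraction_monomial_zero, ite_self, Finset.sum_const_zero]
  · intro n τ
    simp only [LinearMap.sum_apply, LinearMap.comp_apply, proj_monomial]
    rw [Finset.sum_eq_single (totalSet τ)]
    · rw [if_pos rfl, contraction_monomial, map_sum]
      refine Finset.sum_congr rfl fun j _ => ?_
      rw [map_smul, proj_monomial]
      simp only [eq_comm]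
    · intro J _ hJ
      rw [if_neg (Ne.symm hJ)]
      simp
    · simp

end Construction

/-- The differential `d(τ₁ ⋯ τₙ) = ∑ⱼ (-1)^(j+1) τ₁ ⋯ τ̂ⱼ ⋯ τₙ · δⱼ`, where `δⱼ` is `1` if the
removal of `τⱼ` does not change the total set and `0` otherwise. Since the monomials span the
exterior algebra, this formula determines the linear map `d` (see `lam_ext`); it exists by
`exists_differential`. With indices starting at `0` the sign is `(-1)^j`. -/
def differential (k : Type*) [CommRing k] {m : ℕ} (P : Set (Finset (Fin m))) :
    Lam k P →ₗ[k] Lam k P :=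
  Classical.choose (exists_differential k P)

theorem differential_monomial_zero (k : Type*) [CommRing k] {m : ℕ} {P : Set (Finset (Fin m))}
    (τ : Fin 0 → P) : differential k P (monomial k τ) = 0 :=
  (Classical.choose_spec (exists_differential k P)).1 τ

theorem differential_monomial (k : Type*) [CommRing k] {m : ℕ} {P : Set (Finset (Fin m))}
    {n : ℕ} (τ : Fin (n + 1) → P) : differential k P (monomial k τ) =
      ∑ j : Fin (n + 1), (-1 : k) ^ (j : ℕ) •
        if totalSet τ = totalSet (fun l => τ (j.succAbove l))
          then monomial k (fun l => τ (j.succAbove l)) else 0 :=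
  (Classical.choose_spec (exists_differential k P)).2 n τ

theorem differential_mem (k : Type*) [CommRing k] {m : ℕ} (P : Set (Finset (Fin m))) (i : ℕ)
    (J : Finset (Fin m)) {x : Lam k P} (hx : x ∈ bigraded k P (i + 1) J) :
    differential k P x ∈ bigraded k P i J := by
  suffices h : bigraded k P (i + 1) J ≤ (bigraded k P i J).comap (differential k P) from h hx
  refine Submodule.span_le.mpr ?_
  rintro _ ⟨τ, hτ, rfl⟩
  simp only [Submodule.comap_coe, Set.mem_preimage, SetLike.mem_coe, differential_monomial]
  refine Submodule.sum_mem _ fun j _ => Submodule.smul_mem _ _ ?_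
  split_ifs with h
  · exact Submodule.subset_span ⟨_, h ▸ hτ, rfl⟩
  · exact Submodule.zero_mem _

theorem differential_monomial_eq_proj (k : Type*) [CommRing k] {m : ℕ}
    {P : Set (Finset (Fin m))} {n : ℕ} (τ : Fin n → P) :
    differential k P (monomial k τ) = proj k P (totalSet τ) (contraction k P (monomial k τ)) := by
  cases n with
  | zero => rw [differential_monomial_zero, contraction_monomial_zero, map_zero]
  | succ n =>
    rw [differential_monomial, contraction_monomial, map_sum]
    refine Finset.sum_congr rfl fun j _ => ?_
    rw [map_smul, proj_monomial]
    simp only [eq_comm]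

theorem proj_contraction_of_ssubset (k : Type*) [CommRing k] {m : ℕ} {P : Set (Finset (Fin m))}
    {J : Finset (Fin m)} {n : ℕ} (τ : Fin n → P) (h : totalSet τ ⊂ J) :
    proj k P J (contraction k P (monomial k τ)) = 0 := by
  cases n with
  | zero => rw [contraction_monomial_zero, map_zero]
  | succ n =>
    rw [contraction_monomial, map_sum]
    refine Finset.sum_eq_zero fun j _ => ?_
    rw [map_smul, proj_monomial, if_neg, smul_zero]
    intro h'
    exact h.2 (h' ▸ totalSet_succAbove_subset P τ j)

theorem differential_differential (k : Type*) [CommRing k] {m : ℕ} (P : Set (Finset (Fin m)))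
    (x : Lam k P) : differential k P (differential k P x) = 0 := by
  suffices h : differential k P ∘ₗ differential k P = 0 from LinearMap.congr_fun h x
  refine lam_ext k P fun n τ => ?_
  rw [LinearMap.comp_apply, LinearMap.zero_apply]
  cases n with
  | zero => rw [differential_monomial_zero, map_zero]
  | succ n =>
    have key : differential k P (differential k P (monomial k τ)) =
        proj k P (totalSet τ) (contraction k P (contraction k P (monomial k τ))) := by
      rw [differential_monomial, contraction_monomial, map_sum, map_sum, map_sum]
      refine Finset.sum_congr rfl fun j _ => ?_
      rw [map_smul, map_smul, map_smul]
      congr 1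
      split_ifs with h
      · rw [differential_monomial_eq_proj, h]
      · rw [map_zero, proj_contraction_of_ssubset]
        exact (totalSet_succAbove_subset P τ j).ssubset_of_ne (Ne.symm h)
    rw [key, contraction_contraction, map_zero]

/-- The chain complex `(Λ^{*,J}[P], d)`. -/
def lamComplex (k : Type*) [CommRing k] {m : ℕ} (P : Set (Finset (Fin m)))
    (J : Finset (Fin m)) : ChainComplex (ModuleCat k) ℕ :=
  ChainComplex.of (fun i => ModuleCat.of k (bigraded k P i J))
    (fun i => ModuleCat.ofHom
      ((differential k P).restrict fun _ hx => differential_mem k P i J hx))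
    (fun i => by
      refine ModuleCat.hom_ext (LinearMap.ext fun x => Subtype.ext ?_)
      exact differential_differential k P x.1)

/-! ### Reduced simplicial cohomology -/

/-- The `q`-simplices of `K`, for an integer `q`: the simplices with `q + 1` elements. The empty
simplex is the only `(-1)`-simplex, and there are none for `q < -1`. -/
abbrev Simplices {m : ℕ} (K : PreAbstractSimplicialComplex (Fin m)) (q : ℤ) : Type :=
  {σ : Finset (Fin m) // IsSimplex K σ ∧ (σ.card : ℤ) = q + 1}

/-- The facet of a simplex opposite to the vertex `v`. -/
def Simplices.facet {m : ℕ} {K : PreAbstractSimplicialComplex (Fin m)} {q : ℤ}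
    (σ : Simplices K (q + 1)) (v : Fin m) (hv : v ∈ σ.1) : Simplices K q :=
  ⟨σ.1.erase v, σ.2.1.mono (Finset.erase_subset _ _), by
    have h := Finset.card_erase_add_one hv
    have h2 := σ.2.2
    omega⟩

/-- The sign `(-1)^j` of the `j`-th vertex `v` of `σ` (counted from `0`), with respect to the
natural order on the vertices. -/
def vertexSign (k : Type*) [CommRing k] {m : ℕ} (σ : Finset (Fin m)) (v : Fin m) : k :=
  (-1) ^ (σ.filter (· < v)).card

/-- The coboundary of the reduced simplicial cochain complex with coefficients in `k`:
`(δf)(v₀,…,v_{q+1}) = ∑ⱼ (-1)^j f(v₀,…,v̂ⱼ,…,v_{q+1})` for `v₀ < ⋯ < v_{q+1}`. -/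
def coboundary (k : Type*) [CommRing k] {m : ℕ} (K : PreAbstractSimplicialComplex (Fin m))
    (q : ℤ) : (Simplices K q → k) →ₗ[k] (Simplices K (q + 1) → k) where
  toFun f σ := ∑ v : {v // v ∈ σ.1}, vertexSign k σ.1 v.1 * f (σ.facet v.1 v.2)
  map_add' f g := by
    funext σ
    simp [mul_add, Finset.sum_add_distrib]
  map_smul' c f := by
    funext σ
    simp [Finset.mul_sum, mul_left_comm]

theorem vertexSign_antisymm (k : Type*) [CommRing k] {m : ℕ} {σ : Finset (Fin m)} {v w : Fin m}
    (hv : v ∈ σ) (h : v < w) :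
    vertexSign k σ v * vertexSign k (σ.erase v) w =
      - (vertexSign k σ w * vertexSign k (σ.erase w) v) := by
  have h1 : (σ.filter (· < w)).card = ((σ.erase v).filter (· < w)).card + 1 := by
    rw [Finset.filter_erase, Finset.card_erase_add_one (by simp [hv, h])]
  have h2 : (σ.erase w).filter (· < v) = σ.filter (· < v) := by
    rw [Finset.filter_erase, Finset.erase_eq_of_notMem]
    simp [h.le]
  simp only [vertexSign, h1, h2, pow_succ]
  ring

theorem coboundary_coboundary (k : Type*) [CommRing k] {m : ℕ}
    (K : PreAbstractSimplicialComplex (Fin m)) (q : ℤ) (f : Simplices K q → k) :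
    coboundary k K (q + 1) (coboundary k K q f) = 0 := by
  classical
  funext σ
  let F : Finset (Fin m) → k := fun s =>
    if h : IsSimplex K s ∧ (s.card : ℤ) = q + 1 then f ⟨s, h⟩ else 0
  have hF : ∀ s : Simplices K q, f s = F s.1 := fun s => by simp only [F, dif_pos s.2]
  have h1 : coboundary k K (q + 1) (coboundary k K q f) σ =
      ∑ v ∈ σ.1, ∑ w ∈ σ.1.erase v,
        vertexSign k σ.1 v * vertexSign k (σ.1.erase v) w * F ((σ.1.erase v).erase w) := by
    rw [← Finset.sum_coe_sort]
    refine Finset.sum_congr rfl fun v _ => ?_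
    rw [← Finset.sum_coe_sort]
    change _ * (∑ _, _) = _
    rw [Finset.mul_sum]
    refine Finset.sum_congr rfl fun w _ => ?_
    rw [hF, ← mul_assoc]
    rfl
  rw [h1, Finset.sum_sigma']
  refine Finset.sum_involution (fun x _ => ⟨x.2, x.1⟩) ?_ ?_ ?_ ?_
  · rintro ⟨v, w⟩ hx
    simp only [Finset.mem_sigma, Finset.mem_erase] at hx
    obtain ⟨hv, hne, hw⟩ := hx
    simp only [Finset.erase_right_comm (a := w) (b := v)]
    rcases lt_or_gt_of_ne hne with h | h
    · rw [vertexSign_antisymm k hw h]; ring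
    · rw [vertexSign_antisymm k hv h]; ring
  · rintro ⟨v, w⟩ hx _ h
    simp only [Finset.mem_sigma, Finset.mem_erase] at hx
    exact hx.2.1 (congrArg Sigma.fst h)
  · rintro ⟨v, w⟩ hx
    simp only [Finset.mem_sigma, Finset.mem_erase] at hx ⊢
    exact ⟨hx.2.2, Ne.symm hx.2.1, hx.1⟩
  · rintro ⟨v, w⟩ _
    rfl

/-- The reduced simplicial cochain complex of `K` with coefficients in `k`, indexed by the
integers; the augmentation is the coboundary from degree `-1` to degree `0`. -/
def reducedCochainComplex (k : Type*) [CommRing k] {m : ℕ}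
    (K : PreAbstractSimplicialComplex (Fin m)) : CochainComplex (ModuleCat k) ℤ :=
  CochainComplex.of (fun q => ModuleCat.of k (Simplices K q → k))
    (fun q => ModuleCat.ofHom (coboundary k K q))
    (fun q => by
      refine ModuleCat.hom_ext (LinearMap.ext fun f => ?_)
      exact coboundary_coboundary k K q f)

/-- The reduced simplicial cohomology of `K` in degree `q` with coefficients in `k`. -/
abbrev reducedCohomology (k : Type*) [CommRing k] {m : ℕ}
    (K : PreAbstractSimplicialComplex (Fin m)) (q : ℤ) : ModuleCat k :=
  (reducedCochainComplex k K).homology q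

end

end SimplicialComplement

/-! Both sides are the homology of one auxiliary simplicial complex. Its vertices are the members τ
of `P` together with the elements v of [m]; a face is a pair (A, B) such that every member of A is
disjoint from B (`IsBiclique` for the relation `Avoids`). Its chains include the empty face and are
graded by the number of elements.

The faces with ⋃A ≠ [m] (`IsRightCone`) form an acyclic subcomplex, since a point missed by ⋃A can
be added to B. Every other face has ⋃A = [m], hence B = ∅, so the quotient is Λ^{*,[m]}: boundary
terms whose union drops die in the quotient, which is the role of δ_j.

Symmetrically, the faces for which some τ in `P` misses B (`IsLeftCone`) form an acyclic subcomplex,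
since τ can be added to A. As `P` detects non-simplices by containment, every other face has Bᶜ a
simplex of K, and then A = ∅. Removing a point from B adds it to Bᶜ, so this quotient is the reduced
cochain complex, with |B| = n in degree m - n - 1.

Acyclicity is `exists_boundary_eq`; `homology_iso_of_acyclic_kernel` compares the homology with that
of each quotient, through the chain maps of `differential_toLam` and `coboundary_toCochain`. -/

namespace SimplicialComplement

noncomputable section

/-! ### Chains on a simplex and an acyclicity criterion. -/

section Boundary

variable {k : Type*} [CommRing k] {W : Type*} [Fintype W] [DecidableEq W]

/-- The signs `c v s`, the coefficient of the face `s` in the boundary of `insert v s`, make the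
boundary operator of the full simplex a differential. -/
structure IsSignSystem (c : W → Finset W → k) : Prop where
  mul_self : ∀ v s, c v s * c v s = 1
  anticomm : ∀ v w s, v ≠ w → v ∉ s → w ∉ s →
    c v (insert w s) * c w s = -(c w (insert v s) * c v s)

/-- The boundary operator on functions on the faces of the full simplex on `W`. -/
def boundary (c : W → Finset W → k) : (Finset W → k) →ₗ[k] (Finset W → k) where
  toFun f s := ∑ v ∈ sᶜ, c v s * f (insert v s)
  map_add' f g := by
    funext s
    simp [mul_add, Finset.sum_add_distrib]
  map_smul' a f := by
    funext s
    simp [Finset.mul_sum, mul_left_comm]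

theorem boundary_apply (c : W → Finset W → k) (f : Finset W → k) (s : Finset W) :
    boundary c f s = ∑ v ∈ sᶜ, c v s * f (insert v s) := rfl

theorem boundary_boundary {c : W → Finset W → k} (hc : IsSignSystem c) (f : Finset W → k) :
    boundary c (boundary c f) = 0 := by
  funext s
  simp only [boundary_apply, Finset.mul_sum, Pi.zero_apply]
  rw [Finset.sum_sigma']
  refine Finset.sum_involution (fun x _ => ⟨x.2, x.1⟩) ?_ ?_ ?_ ?_
  · rintro ⟨v, w⟩ hx
    simp only [Finset.mem_sigma, Finset.mem_compl, Finset.mem_insert, not_or] at hx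
    have h := hc.anticomm v w s (Ne.symm hx.2.1) hx.1 hx.2.2
    have h2 : insert v (insert w s) = insert w (insert v s) := Finset.insert_comm _ _ _
    simp only [h2]
    linear_combination f (insert w (insert v s)) * h
  · rintro ⟨v, w⟩ hx _ h
    simp only [Finset.mem_sigma, Finset.mem_compl, Finset.mem_insert, not_or] at hx
    exact hx.2.1 (congrArg Sigma.fst h)
  · rintro ⟨v, w⟩ hx
    simp only [Finset.mem_sigma, Finset.mem_compl, Finset.mem_insert, not_or] at hx ⊢
    exact ⟨hx.2.2, Ne.symm hx.2.1, hx.1⟩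
  · rintro ⟨v, w⟩ _
    rfl

variable (k) in
/-- The functions supported on the faces with `n` elements in the family `F`. -/
def supported (F : Finset W → Prop) (n : ℤ) : Submodule k (Finset W → k) where
  carrier := {f | ∀ s, f s ≠ 0 → F s ∧ (s.card : ℤ) = n}
  zero_mem' := by simp
  add_mem' := by
    intro f g hf hg s hs
    by_cases h : f s = 0
    · exact hg s (by simpa [h] using hs)
    · exact hf s h
  smul_mem' := by
    intro a f hf s hs
    exact hf s (right_ne_zero_of_mul (by simpa using hs))

omit [Fintype W] [DecidableEq W] in
theorem mem_supported {F : Finset W → Prop} {n : ℤ} {f : Finset W → k} :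
    f ∈ supported k F n ↔ ∀ s, f s ≠ 0 → F s ∧ (s.card : ℤ) = n := Iff.rfl

omit [Fintype W] [DecidableEq W] in
theorem supported_mono {F G : Finset W → Prop} (h : ∀ s, F s → G s) (n : ℤ) :
    supported k F n ≤ supported k G n :=
  fun _ hf s hs => ⟨h s (hf s hs).1, (hf s hs).2⟩

theorem boundary_mem {F : Finset W → Prop} (hF : ∀ s t, s ⊆ t → F t → F s)
    (c : W → Finset W → k) {n : ℤ} {f : Finset W → k} (hf : f ∈ supported k F (n + 1)) :
    boundary c f ∈ supported k F n := by
  intro s hs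
  rw [boundary_apply] at hs
  obtain ⟨v, hv, h⟩ := Finset.exists_ne_zero_of_sum_ne_zero hs
  have h1 := hf _ (right_ne_zero_of_mul h)
  rw [Finset.card_insert_of_notMem (Finset.mem_compl.mp hv)] at h1
  exact ⟨hF _ _ (Finset.subset_insert _ _) h1.1, by have := h1.2; push_cast at this; omega⟩

/-- A subcomplex of the full simplex is acyclic if its faces can be matched by adding and removing
a vertex `b s` which depends on `s` in a controlled way: enlarging the face either does not change
it, or increases a rank `r`. -/
theorem exists_boundary_eq {c : W → Finset W → k} (hc : IsSignSystem c)
    {F : Finset W → Prop} (hF : ∀ s t, s ⊆ t → F t → F s) (b : Finset W → W) (r : Finset W → ℕ)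
    (hbF : ∀ s, F s → F (insert (b s) s)) (hb : ∀ s, b (s.erase (b s)) = b s)
    (hbi : ∀ s, b (insert (b s) s) = b s)
    (hr : ∀ s, r (s.erase (b s)) = r s)
    (hbr : ∀ s v, v ∉ s → r s < r (insert v s) ∨ (r s = r (insert v s) ∧ b s = b (insert v s)))
    (n : ℤ) (x : Finset W → k) (hx : x ∈ supported k F n) (hdx : boundary c x = 0) :
    ∃ u ∈ supported k F (n + 1), boundary c u = x := by
  -- Induction on a strict bound N for the rank on the support of x; each stage subtracts a boundary
  -- that clears the top rank.
  suffices H : ∀ N : ℕ, ∀ x ∈ supported k F n, boundary c x = 0 → (∀ s, x s ≠ 0 → r s < N) →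
      ∃ u ∈ supported k F (n + 1), boundary c u = x by
    refine H ((Finset.univ.sup r) + 1) x hx hdx fun s _ => Nat.lt_succ_of_le ?_
    exact Finset.le_sup (Finset.mem_univ s)
  intro N
  induction N with
  | zero =>
    intro x _ _ h
    refine ⟨0, zero_mem _, ?_⟩
    funext s
    by_contra hs
    exact absurd (h s (fun h0 => hs (by simp [h0]))) (Nat.not_lt_zero _)
  | succ N ih =>
    intro x hx hdx hN
    -- The cone over x along the matching: each value of x at a face moves to that face with its
    -- matched vertex added.
    let h : Finset W → k := fun s =>
      if b s ∈ s then c (b s) (s.erase (b s)) * x (s.erase (b s)) else 0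
    have hh : h ∈ supported k F (n + 1) := by
      intro s hs
      simp only [h] at hs
      split_ifs at hs with hbs
      · have h1 := hx _ (right_ne_zero_of_mul hs)
        have h2 := hbF _ h1.1
        rw [hb, Finset.insert_erase hbs] at h2
        refine ⟨h2, ?_⟩
        rw [← h1.2, ← Finset.card_erase_add_one hbs]
        push_cast; rfl
      · exact absurd rfl hs
    have hdh : boundary c h ∈ supported k F n := boundary_mem hF c hh
    have hvan : ∀ s, r s < N + 1 ∨ x s = 0 := fun s => by
      by_cases h0 : x s = 0
      · exact Or.inr h0
      · exact Or.inl (hN s h0)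
    -- In ranks at least N, `b (insert v s)` may be replaced by `b s`: if adding v raises the rank,
    -- then x vanishes on the faces involved and both sides are 0.
    have hstep : ∀ s v, N ≤ r s → v ∉ s → h (insert v s) =
        if b s ∈ insert v s then c (b s) ((insert v s).erase (b s)) *
          x ((insert v s).erase (b s)) else 0 := by
      intro s v hs hv
      rcases hbr s v hv with hlt | ⟨_, heq⟩
      · have e1 : h (insert v s) = 0 := by
          simp only [h]
          split_ifs with hbs
          · rcases hvan ((insert v s).erase (b (insert v s))) with h1 | h1
            · rw [hr] at h1; omega
            · rw [h1, mul_zero]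
          · rfl
        rw [e1]
        split_ifs with hbs
        · have hbv : b s ≠ v := by
            rintro rfl
            have h1 := hr (insert (b s) s)
            rw [hbi, Finset.erase_insert hv] at h1
            omega
          have hbs' : b s ∈ s := (Finset.mem_insert.mp hbs).resolve_left hbv
          have ht : (insert v s).erase (b s) = insert v (s.erase (b s)) :=
            Finset.erase_insert_of_ne hbv.symm
          rw [ht]
          rcases hvan (insert v (s.erase (b s))) with h1 | h1
          · rcases hbr (s.erase (b s)) v (fun h2 => hv (Finset.mem_of_mem_erase h2)) with h2 | h2
            · rw [hr] at h2; omega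
            · rw [hr, hb] at h2
              have h3 := hbi (insert v (s.erase (b s)))
              rw [← h2.2, ← ht, Finset.insert_erase hbs] at h3
              have h4 := hr (insert v s)
              rw [h3, ht, ← h2.1] at h4
              omega
          · rw [h1, mul_zero]
        · rfl
      · simp only [h, heq]
    have hres : ∀ s, N ≤ r s → boundary c h s = x s := by
      intro s hs
      rw [boundary_apply]
      have hsum : ∀ v ∈ sᶜ, c v s * h (insert v s) = c v s *
          if b s ∈ insert v s then c (b s) ((insert v s).erase (b s)) *
            x ((insert v s).erase (b s)) else 0 := fun v hv => by
        rw [hstep s v hs (Finset.mem_compl.mp hv)]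
      rw [Finset.sum_congr rfl hsum]
      by_cases hbs : b s ∈ s
      -- The cycle condition at `s.erase (b s)` expresses `x s` through the remaining terms;
      -- anticommutation of signs turns these into the boundary of h.
      · have h1 := congrFun hdx (s.erase (b s))
        rw [boundary_apply, Finset.compl_erase,
          Finset.sum_insert (by simpa using hbs), Finset.insert_erase hbs] at h1
        have h2 : ∀ v ∈ sᶜ, (c v s * if b s ∈ insert v s then c (b s) ((insert v s).erase (b s)) *
            x ((insert v s).erase (b s)) else 0) = -c (b s) (s.erase (b s)) *
            (c v (s.erase (b s)) * x (insert v (s.erase (b s)))) := by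
          intro v hv
          have hv : v ∉ s := Finset.mem_compl.mp hv
          have hbv : b s ≠ v := fun h => hv (h ▸ hbs)
          rw [if_pos (Finset.mem_insert_of_mem hbs), Finset.erase_insert_of_ne hbv.symm]
          have h3 := hc.anticomm v (b s) (s.erase (b s)) hbv.symm
            (fun h => hv (Finset.mem_of_mem_erase h)) (Finset.notMem_erase _ _)
          rw [Finset.insert_erase hbs] at h3
          have h4 := hc.mul_self (b s) (s.erase (b s))
          have h5 := hc.mul_self (b s) (insert v (s.erase (b s)))
          generalize c (b s) (insert v (s.erase (b s))) = p at *
          generalize c (b s) (s.erase (b s)) = q at *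
          generalize x (insert v (s.erase (b s))) = y at *
          linear_combination (p * q * y) * h3 - (c v s * p * y) * h4
            - (q * c v (s.erase (b s)) * y) * h5
        rw [Finset.sum_congr rfl h2, ← Finset.mul_sum]
        have h4 := hc.mul_self (b s) (s.erase (b s))
        simp only [Pi.zero_apply] at h1
        linear_combination -c (b s) (s.erase (b s)) * h1 + x s * h4
      · rw [Finset.sum_eq_single_of_mem (b s) (Finset.mem_compl.mpr hbs)]
        · rw [if_pos (Finset.mem_insert_self _ _), Finset.erase_insert hbs, ← mul_assoc,
            hc.mul_self, one_mul]
        · intro v _ hvb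
          rw [if_neg, mul_zero]
          simp [hbs, hvb.symm]
    obtain ⟨u, hu, hdu⟩ := ih (x - boundary c h) (sub_mem hx hdh)
      (by rw [map_sub, hdx, boundary_boundary hc, sub_zero])
      (fun s hs => by
        by_contra hlt
        exact hs (by simp [hres s (not_lt.mp hlt)]))
    exact ⟨u + h, add_mem hu hh, by rw [map_add, hdu, sub_add_cancel]⟩

end Boundary

/-! ### Homology of a quotient by an acyclic subcomplex. -/

section AcyclicKernel

universe u v w

/-- The homology of `T₁ → T₀ → E`, where `T₁` and `T₀` are submodules of the module `E` with
differential `d`. -/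
abbrev CycleQuotient {k : Type u} [CommRing k] {E : Type w} [AddCommGroup E] [Module k E]
    (d : E →ₗ[k] E) (T₁ T₀ : Submodule k E) : Type w :=
  LinearMap.ker (d.domRestrict T₀) ⧸
    (T₁.map d).comap (T₀.subtype ∘ₗ (LinearMap.ker (d.domRestrict T₀)).subtype)

/-- The homology of a short complex of modules that receives a surjection with acyclic kernel from
a complex `T₁ → T₀ → E`, expressed by the cycles and boundaries of that complex. -/
theorem homology_iso_of_acyclic_kernel {k : Type u} [CommRing k] (S : ShortComplex (ModuleCat.{v} k))
    {E : Type w} [AddCommGroup E] [Module k E] (d : E →ₗ[k] E) (T₁ T₀ : Submodule k E)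
    (hT : ∀ y ∈ T₁, d y ∈ T₀) (hdd : ∀ y, d (d y) = 0)
    (φ₁ : T₁ → S.X₁) (φ₀ : T₀ →ₗ[k] S.X₂)
    (hφ : ∀ y : T₁, S.f (φ₁ y) = φ₀ ⟨d y, hT y y.2⟩)
    (hφ₁ : Function.Surjective φ₁) (hφ₀ : Function.Surjective φ₀)
    (hcycle : ∀ x : T₀, d x = 0 → S.g (φ₀ x) = 0)
    (hlift : ∀ x : T₀, S.g (φ₀ x) = 0 → ∃ u : T₀, φ₀ u = 0 ∧ d u = d x)
    (hexact : ∀ x : T₀, φ₀ x = 0 → d x = 0 → ∃ u ∈ T₁, d u = x) :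
    Nonempty (S.homology ≃ₗ[k] CycleQuotient d T₁ T₀) := by
  let Z := LinearMap.ker (d.domRestrict T₀)
  have hZ : ∀ z : Z, d z.1 = 0 := fun z => z.2
  let ψ : Z →ₗ[k] LinearMap.ker S.g.hom :=
    (φ₀ ∘ₗ Z.subtype).codRestrict _ fun z => hcycle z.1 (hZ z)
  let q := (LinearMap.range S.moduleCatToCycles).mkQ ∘ₗ ψ
  have hq : Function.Surjective q := by
    refine (Submodule.mkQ_surjective _).comp ?_
    rintro ⟨a, ha⟩
    obtain ⟨x, rfl⟩ := hφ₀ a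
    -- A lift of a cycle need not be a cycle; an element of the kernel with the same boundary
    -- corrects it.
    obtain ⟨u, hu, hdu⟩ := hlift x ha
    refine ⟨⟨x - u, ?_⟩, Subtype.ext ?_⟩
    · change d ((x - u : T₀) : E) = 0
      simp [hdu]
    · change φ₀ (x - u) = φ₀ x
      simp [hu]
  have hker : LinearMap.ker q = (T₁.map d).comap (T₀.subtype ∘ₗ Z.subtype) := by
    ext z
    simp only [q, LinearMap.mem_ker, LinearMap.comp_apply, Submodule.mkQ_apply,
      Submodule.Quotient.mk_eq_zero, LinearMap.mem_range, Submodule.mem_comap,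
      Submodule.subtype_apply, Submodule.mem_map]
    constructor
    · rintro ⟨a, ha⟩
      obtain ⟨y, rfl⟩ := hφ₁ a
      have h1 : S.f (φ₁ y) = φ₀ z.1 := congrArg Subtype.val ha
      rw [hφ] at h1
      -- The difference of z and d y is a cycle in the kernel, so it bounds there.
      obtain ⟨u, hu, hdu⟩ := hexact (z.1 - ⟨d y, hT y y.2⟩) (by rw [map_sub, h1, sub_self])
        (by simp [hZ, hdd])
      refine ⟨u + y, add_mem hu y.2, ?_⟩
      rw [map_add, hdu]
      simp
    · rintro ⟨y, hy, hdy⟩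
      refine ⟨φ₁ ⟨y, hy⟩, Subtype.ext ?_⟩
      change S.f (φ₁ ⟨y, hy⟩) = φ₀ z.1
      rw [hφ]
      congr 1
      exact Subtype.ext hdy
  exact ⟨S.moduleCatHomologyIso.toLinearEquiv ≪≫ₗ (q.quotKerEquivOfSurjective hq).symm ≪≫ₗ
    Submodule.quotEquivOfEq _ _ hker⟩

end AcyclicKernel

/-! ### Bicliques of a relation and their acyclic cone subcomplexes. -/

section Incidence

variable {k : Type*} [CommRing k] {α β : Type*}

theorem toLeft_erase_inr [DecidableEq α] [DecidableEq β] (s : Finset (α ⊕ β)) (b : β) :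
    (s.erase (Sum.inr b)).toLeft = s.toLeft := by ext; simp

theorem toRight_erase_inl [DecidableEq α] [DecidableEq β] (s : Finset (α ⊕ β)) (a : α) :
    (s.erase (Sum.inl a)).toRight = s.toRight := by ext; simp

/-- The faces of the complex of pairs of sets that are pairwise related. -/
def IsBiclique (R : α → β → Prop) (s : Finset (α ⊕ β)) : Prop :=
  ∀ a b, Sum.inl a ∈ s → Sum.inr b ∈ s → R a b

theorem IsBiclique.anti {R : α → β → Prop} (s t : Finset (α ⊕ β)) (h : s ⊆ t)
    (ht : IsBiclique R t) : IsBiclique R s :=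
  fun a b ha hb => ht a b (h ha) (h hb)

/-- The bicliques whose left part has a common neighbour. -/
def IsRightCone (R : α → β → Prop) (s : Finset (α ⊕ β)) : Prop :=
  IsBiclique R s ∧ ∃ b, ∀ a, Sum.inl a ∈ s → R a b

/-- The bicliques whose right part has a common neighbour. -/
def IsLeftCone (R : α → β → Prop) (s : Finset (α ⊕ β)) : Prop :=
  IsBiclique R s ∧ ∃ a, ∀ b, Sum.inr b ∈ s → R a b

variable [Fintype α] [Fintype β] [DecidableEq α] [DecidableEq β]

/-- The matched vertex is a common neighbour chosen from the left part alone. Adding a right vertex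
does not affect the choice, and adding a left vertex raises the rank, which is the size of the left
part. -/
theorem exists_boundary_eq_isRightCone {c : α ⊕ β → Finset (α ⊕ β) → k} (hc : IsSignSystem c)
    (R : α → β → Prop) (n : ℤ) (x : Finset (α ⊕ β) → k) (hx : x ∈ supported k (IsRightCone R) n)
    (hdx : boundary c x = 0) : ∃ u ∈ supported k (IsRightCone R) (n + 1), boundary c u = x := by
  classical
  by_cases hne : Nonempty β
  · let g : Finset α → β := fun A => Classical.epsilon fun b => ∀ a ∈ A, R a b
    have hg : ∀ A : Finset α, (∃ b, ∀ a ∈ A, R a b) → ∀ a ∈ A, R a (g A) :=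
      fun A h => Classical.epsilon_spec h
    refine exists_boundary_eq hc ?_ (fun s => Sum.inr (g s.toLeft)) (fun s => s.toLeft.card)
      ?_ ?_ ?_ ?_ ?_ n x hx hdx
    · rintro s t h ⟨h1, b, hb⟩
      exact ⟨h1.anti s t h, b, fun a ha => hb a (h ha)⟩
    · rintro s ⟨h1, h2⟩
      have h3 := hg s.toLeft (by simpa using h2)
      refine ⟨?_, ?_⟩
      · intro a b ha hb
        have ha : Sum.inl a ∈ s := by simpa using ha
        rcases Finset.mem_insert.mp hb with hb | hb
        · rw [Sum.inr.inj hb]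
          exact h3 a (Finset.mem_toLeft.mpr ha)
        · exact h1 a b ha hb
      · simpa using h2
    · intro s; simp only [toLeft_erase_inr]
    · intro s; simp only [Finset.toLeft_insert_inr]
    · intro s; simp only [toLeft_erase_inr]
    · rintro s (a | b) hv
      · left
        rw [Finset.toLeft_insert_inl, Finset.card_insert_of_notMem (by simpa using hv)]
        exact Nat.lt_succ_self _
      · right
        simp only [Finset.toLeft_insert_inr, and_self]
  -- If β is empty there are no right cones, so x = 0.
  · refine ⟨0, zero_mem _, ?_⟩
    funext s
    by_contra hs
    exact hne ⟨(hx s (fun h0 => hs (by simp [h0]))).1.2.choose⟩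

/-- The mirror image: the matched vertex depends on the right part alone, whose size is the rank. -/
theorem exists_boundary_eq_isLeftCone {c : α ⊕ β → Finset (α ⊕ β) → k} (hc : IsSignSystem c)
    (R : α → β → Prop) (n : ℤ) (x : Finset (α ⊕ β) → k) (hx : x ∈ supported k (IsLeftCone R) n)
    (hdx : boundary c x = 0) : ∃ u ∈ supported k (IsLeftCone R) (n + 1), boundary c u = x := by
  classical
  by_cases hne : Nonempty α
  · let g : Finset β → α := fun B => Classical.epsilon fun a => ∀ b ∈ B, R a b
    have hg : ∀ B : Finset β, (∃ a, ∀ b ∈ B, R a b) → ∀ b ∈ B, R (g B) b :=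
      fun A h => Classical.epsilon_spec h
    refine exists_boundary_eq hc ?_ (fun s => Sum.inl (g s.toRight)) (fun s => s.toRight.card)
      ?_ ?_ ?_ ?_ ?_ n x hx hdx
    · rintro s t h ⟨h1, a, ha⟩
      exact ⟨h1.anti s t h, a, fun b hb => ha b (h hb)⟩
    · rintro s ⟨h1, h2⟩
      have h3 := hg s.toRight (by simpa using h2)
      refine ⟨?_, ?_⟩
      · intro a b ha hb
        have hb : Sum.inr b ∈ s := by simpa using hb
        rcases Finset.mem_insert.mp ha with ha | ha
        · rw [Sum.inl.inj ha]
          exact h3 b (Finset.mem_toRight.mpr hb)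
        · exact h1 a b ha hb
      · simpa using h2
    · intro s; simp only [toRight_erase_inl]
    · intro s; simp only [Finset.toRight_insert_inl]
    · intro s; simp only [toRight_erase_inl]
    · rintro s (a | b) hv
      · right
        simp only [Finset.toRight_insert_inl, and_self]
      · left
        rw [Finset.toRight_insert_inr, Finset.card_insert_of_notMem (by simpa using hv)]
        exact Nat.lt_succ_self _
  · refine ⟨0, zero_mem _, ?_⟩
    funext s
    by_contra hs
    exact hne ⟨(hx s (fun h0 => hs (by simp [h0]))).1.2.choose⟩

theorem boundary_disjSum (c : α ⊕ β → Finset (α ⊕ β) → k) (f : Finset (α ⊕ β) → k)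
    (A : Finset α) (B : Finset β) :
    boundary c f (A.disjSum B) =
      ∑ a ∈ Aᶜ, c (Sum.inl a) (A.disjSum B) * f ((insert a A).disjSum B) +
      ∑ b ∈ Bᶜ, c (Sum.inr b) (A.disjSum B) * f (A.disjSum (insert b B)) := by
  have h1 : (A.disjSum B)ᶜ = Aᶜ.disjSum Bᶜ := by
    ext (a | b) <;> simp
  have h2 : ∀ a, insert (Sum.inl a) (A.disjSum B) = (insert a A).disjSum B := fun a => by
    ext (x | x) <;> simp
  have h3 : ∀ b, insert (Sum.inr b) (A.disjSum B) = A.disjSum (insert b B) := fun b => by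
    ext (x | x) <;> simp
  simp only [boundary_apply, h1, Finset.sum_disjSum, h2, h3]

end Incidence

/-! ### Signs compatible with both quotients. -/

section Signs

variable (k : Type*) [CommRing k] {α β : Type*} [LinearOrder α] [LinearOrder β] [Fintype β]

/-- The sign system on a disjoint union which uses the position in the set on the left part, and
the position in the complementary set on the right part. -/
def sumSign : α ⊕ β → Finset (α ⊕ β) → k
  | Sum.inl a, s => (-1) ^ (s.toLeft.filter (· < a)).card
  | Sum.inr b, s => (-1) ^ s.toLeft.card * (-1) ^ (s.toRightᶜ.filter (· < b)).card

theorem neg_one_pow_mul_self (n : ℕ) : (-1 : k) ^ n * (-1) ^ n = 1 := by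
  rw [← mul_pow]; simp

theorem card_filter_insert_lt (s : Finset α) {a b : α} (hb : b ∉ s) :
    ((insert b s).filter (· < a)).card = (s.filter (· < a)).card + if b < a then 1 else 0 := by
  rw [Finset.filter_insert]
  split_ifs with h
  · rw [Finset.card_insert_of_notMem (by simp [hb])]
  · rfl

/-- Adding a vertex to the right part deletes it from the complement, so the usual comparison of
positions runs backwards there. The factor given by the size of the left part makes mixed pairs
anticommute. -/
theorem isSignSystem_sumSign : IsSignSystem (sumSign k : α ⊕ β → Finset (α ⊕ β) → k) where
  mul_self := by
    rintro (a | b) s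
    · exact neg_one_pow_mul_self k _
    · simp only [sumSign]
      rw [mul_mul_mul_comm, neg_one_pow_mul_self, neg_one_pow_mul_self, mul_one]
  anticomm := by
    have hcompl : ∀ (s : Finset β) (b b' : β), b ∉ s → (sᶜ.filter (· < b')).card =
        ((insert b s)ᶜ.filter (· < b')).card + if b < b' then 1 else 0 := fun s b b' hb => by
      rw [← card_filter_insert_lt _ (by simp), Finset.compl_insert, Finset.insert_erase (by simpa)]
    rintro (a | b) (a' | b') s hne hv hw
    · have hv' : a ∉ s.toLeft := by simpa using hv
      have hw' : a' ∉ s.toLeft := by simpa using hw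
      simp only [sumSign, Finset.toLeft_insert_inl, card_filter_insert_lt _ hv',
        card_filter_insert_lt _ hw']
      rcases lt_or_gt_of_ne (fun h => hne (congrArg Sum.inl h) : a ≠ a') with h | h
      · rw [if_pos h, if_neg h.le.not_gt]; ring
      · rw [if_pos h, if_neg h.le.not_gt]; ring
    · have hv' : a ∉ s.toLeft := by simpa using hv
      simp only [sumSign, Finset.toLeft_insert_inl, Finset.toLeft_insert_inr,
        Finset.toRight_insert_inl, Finset.card_insert_of_notMem hv']
      ring
    · have hw' : a' ∉ s.toLeft := by simpa using hw
      simp only [sumSign, Finset.toLeft_insert_inl, Finset.toLeft_insert_inr,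
        Finset.toRight_insert_inl, Finset.card_insert_of_notMem hw']
      ring
    · have hv' : b ∉ s.toRight := by simpa using hv
      have hw' : b' ∉ s.toRight := by simpa using hw
      simp only [sumSign, Finset.toLeft_insert_inr, Finset.toRight_insert_inr]
      rw [hcompl s.toRight b b' hv', hcompl s.toRight b' b hw']
      rcases lt_or_gt_of_ne (fun h => hne (congrArg Sum.inr h) : b ≠ b') with h | h
      · rw [if_pos h, if_neg h.le.not_gt]; ring
      · rw [if_pos h, if_neg h.le.not_gt]; ring

end Signs

/-! ### The exterior algebra in total set [m] as the quotient by right cones. -/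

section Monomials

variable (k : Type*) [CommRing k] {m : ℕ} {P : Set (Finset (Fin m))} {N : ℕ} (e : Fin N ≃ P)

/-- The union of the members of `P` with indices in `S`. -/
def unionOf (S : Finset (Fin N)) : Finset (Fin m) :=
  S.biUnion fun j => (e j : Finset (Fin m))

/-- The basis of the exterior algebra consisting of the squarefree monomials in increasing order. -/
def lamBasis : Module.Basis (Finset (Fin N)) k (Lam k P) :=
  ((Finsupp.basisSingleOne (R := k) (ι := P)).reindex e.symm).ExteriorAlgebra

theorem lamBasis_apply {S : Finset (Fin N)} {n : ℕ} (h : S.card = n) :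
    lamBasis k e S = monomial k fun j => e (S.orderEmbOfFin h j) := by
  rw [lamBasis, ExteriorAlgebra.basis_apply_ofCard _ h, monomial, ExteriorAlgebra.ιMulti_family]
  congr 1
  funext j
  simp [Set.powersetCard.ofFinEmbEquiv_symm_apply]

theorem totalSet_eq_unionOf {n : ℕ} (σ : Fin n → Fin N) :
    totalSet (fun j => e (σ j)) = unionOf e (Finset.univ.image σ) := by
  ext x; simp [totalSet, unionOf]

theorem totalSet_orderEmbOfFin {S : Finset (Fin N)} {n : ℕ} (h : S.card = n) :
    totalSet (fun j => e (S.orderEmbOfFin h j)) = unionOf e S := by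
  rw [totalSet_eq_unionOf, Finset.image_orderEmbOfFin_univ]

theorem monomial_eq_zero {n : ℕ} {τ : Fin n → P} (h : ¬ Function.Injective τ) :
    monomial k τ = 0 := by
  simp only [Function.Injective, not_forall] at h
  obtain ⟨a, b, hab, hne⟩ := h
  exact AlternatingMap.map_eq_zero_of_eq _ _ (by simp [hab]) hne

theorem monomial_eq_smul_lamBasis {n : ℕ} {σ : Fin n → Fin N} (hσ : Function.Injective σ) :
    ∃ u : ℤˣ, monomial k (fun j => e (σ j)) = u • lamBasis k e (Finset.univ.image σ) := by
  have hcard : (Finset.univ.image σ).card = n := by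
    rw [Finset.card_image_of_injective _ hσ, Finset.card_fin]
  have hmono : StrictMono (σ ∘ Tuple.sort σ) :=
    (Tuple.monotone_sort σ).strictMono_of_injective (hσ.comp (Tuple.sort σ).injective)
  have h1 := Finset.orderEmbOfFin_unique hcard (f := σ ∘ Tuple.sort σ) (by simp) hmono
  refine ⟨(Equiv.Perm.sign (Tuple.sort σ))⁻¹, ?_⟩
  rw [lamBasis_apply k e hcard, ← h1, eq_inv_smul_iff]
  exact (AlternatingMap.map_perm (ExteriorAlgebra.ιMulti k n)
    (fun j => Finsupp.single (e (σ j)) (1 : k)) (Tuple.sort σ)).symm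

/-- The spanning monomials may be unsorted or have repeated factors; sorting costs only a sign and
repetitions give 0, so the bigrading can be read off from basis coordinates. -/
theorem mem_bigraded_iff {n : ℕ} {J : Finset (Fin m)} {x : Lam k P} :
    x ∈ bigraded k P n J ↔
      ∀ S, (lamBasis k e).repr x S ≠ 0 → S.card = n ∧ unionOf e S = J := by
  constructor
  · intro hx
    induction hx using Submodule.span_induction with
    | mem x hx =>
      obtain ⟨τ, hτ, rfl⟩ := hx
      intro S hS
      by_cases hinj : Function.Injective τ
      · have hσ : Function.Injective fun j => e.symm (τ j) := e.symm.injective.comp hinj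
        obtain ⟨u, hu⟩ := monomial_eq_smul_lamBasis k e hσ
        simp only [Equiv.apply_symm_apply] at hu
        have hS' : Finset.univ.image (fun j => e.symm (τ j)) = S := by
          by_contra hne
          apply hS
          rw [hu, Units.smul_def, map_zsmul, Module.Basis.repr_self, Finsupp.smul_apply,
            Finsupp.single_eq_of_ne (Ne.symm hne), smul_zero]
        subst hS'
        rw [Finset.card_image_of_injective _ hσ, Finset.card_fin, ← totalSet_eq_unionOf]
        simpa using hτ
      · rw [monomial_eq_zero k hinj] at hS
        simp at hS
    | zero => simp
    | add x y _ _ hx hy =>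
      intro S hS
      by_cases h : (lamBasis k e).repr x S = 0
      · exact hy S (by simpa [h] using hS)
      · exact hx S h
    | smul a x _ hx =>
      intro S hS
      exact hx S (right_ne_zero_of_mul (by simpa using hS))
  · intro h
    rw [← (lamBasis k e).sum_repr x]
    refine Submodule.sum_mem _ fun S _ => ?_
    by_cases hS : (lamBasis k e).repr x S = 0
    · rw [hS, zero_smul]; exact zero_mem _
    · obtain ⟨h1, h2⟩ := h S hS
      refine Submodule.smul_mem _ _ (Submodule.subset_span ⟨_, ?_, lamBasis_apply k e h1⟩)
      rw [totalSet_orderEmbOfFin, h2]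

theorem orderEmbOfFin_succAbove {S : Finset (Fin N)} {n : ℕ} (h : S.card = n + 1)
    (j : Fin (n + 1)) (h' : (S.erase (S.orderEmbOfFin h j)).card = n) (l : Fin n) :
    S.orderEmbOfFin h (j.succAbove l) = (S.erase (S.orderEmbOfFin h j)).orderEmbOfFin h' l := by
  refine congrFun (Finset.orderEmbOfFin_unique h'
    (f := fun l => S.orderEmbOfFin h (j.succAbove l)) (fun l => ?_) ?_) l
  · exact Finset.mem_erase.mpr ⟨fun h2 => Fin.succAbove_ne j l ((S.orderEmbOfFin h).injective h2),
      Finset.orderEmbOfFin_mem _ _ _⟩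
  · exact (S.orderEmbOfFin h).strictMono.comp (Fin.strictMono_succAbove j)

theorem card_filter_lt_orderEmbOfFin {S : Finset (Fin N)} {n : ℕ} (h : S.card = n)
    (j : Fin n) : ((S.erase (S.orderEmbOfFin h j)).filter (· < S.orderEmbOfFin h j)).card = j := by
  have h1 : (S.erase (S.orderEmbOfFin h j)).filter (· < S.orderEmbOfFin h j) =
      (Finset.univ.filter (· < j)).map (S.orderEmbOfFin h).toEmbedding := by
    ext x
    simp only [Finset.mem_filter, Finset.mem_erase, Finset.mem_map, Finset.mem_univ, true_and,
      RelEmbedding.coe_toEmbedding]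
    constructor
    · rintro ⟨⟨_, hx⟩, hlt⟩
      have hx' : x ∈ Set.range (S.orderEmbOfFin h) := by rw [Finset.range_orderEmbOfFin]; exact hx
      obtain ⟨l, rfl⟩ := hx'
      exact ⟨l, by simpa using hlt, rfl⟩
    · rintro ⟨l, hl, rfl⟩
      have hlt : S.orderEmbOfFin h l < S.orderEmbOfFin h j := by simpa using hl
      exact ⟨⟨hlt.ne, Finset.orderEmbOfFin_mem _ _ _⟩, hlt⟩
  rw [h1, Finset.card_map, ← Fin.card_Iio j]
  congr 1
  ext x
  simp

theorem differential_lamBasis (S : Finset (Fin N)) :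
    differential k P (lamBasis k e S) =
      ∑ a ∈ S, (-1 : k) ^ ((S.erase a).filter (· < a)).card •
        if unionOf e S = unionOf e (S.erase a) then lamBasis k e (S.erase a) else 0 := by
  rcases h : S.card with _ | n
  · rw [lamBasis_apply k e h, differential_monomial_zero]
    rw [Finset.card_eq_zero] at h
    subst h
    simp
  · have hc : ∀ j, (S.erase (S.orderEmbOfFin h j)).card = n := fun j => by
      rw [Finset.card_erase_of_mem (Finset.orderEmbOfFin_mem _ _ _), h, Nat.add_sub_cancel]
    rw [lamBasis_apply k e h, differential_monomial]
    conv_rhs => rw [← Finset.map_orderEmbOfFin_univ S h, Finset.sum_map]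
    simp only [Finset.map_orderEmbOfFin_univ, RelEmbedding.coe_toEmbedding]
    refine Finset.sum_congr rfl fun j _ => ?_
    rw [card_filter_lt_orderEmbOfFin, lamBasis_apply k e (hc j)]
    simp only [orderEmbOfFin_succAbove h j (hc j), totalSet_orderEmbOfFin]

/-- The element of the exterior algebra whose coefficients in total set `[m]` are the values of a
function on the faces without a right part. -/
def toLam : (Finset (Fin N ⊕ Fin m) → k) →ₗ[k] Lam k P where
  toFun f := ∑ S, (if unionOf e S = Finset.univ then f (S.disjSum ∅) else 0) • lamBasis k e S
  map_add' f g := by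
    rw [← Finset.sum_add_distrib]
    refine Finset.sum_congr rfl fun S _ => ?_
    split_ifs <;> simp [add_smul]
  map_smul' c f := by
    rw [Finset.smul_sum]
    refine Finset.sum_congr rfl fun S _ => ?_
    split_ifs <;> simp [mul_smul]

theorem toLam_apply (f : Finset (Fin N ⊕ Fin m) → k) : toLam k e f =
    ∑ S, (if unionOf e S = Finset.univ then f (S.disjSum ∅) else 0) • lamBasis k e S := rfl

theorem repr_toLam (f : Finset (Fin N ⊕ Fin m) → k) (S : Finset (Fin N)) :
    (lamBasis k e).repr (toLam k e f) S =
      if unionOf e S = Finset.univ then f (S.disjSum ∅) else 0 := by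
  rw [toLam_apply, (lamBasis k e).repr_sum_self]

/-- A vertex avoids a member of `P`. -/
def Avoids (j : Fin N) (v : Fin m) : Prop := v ∉ (e j : Finset (Fin m))

theorem unionOf_eq_univ_iff (S : Finset (Fin N)) :
    unionOf e S = Finset.univ ↔ ∀ v, ∃ j ∈ S, ¬ Avoids e j v := by
  simp [unionOf, Finset.eq_univ_iff_forall, Avoids]

theorem toLam_mem {n : ℕ} {f : Finset (Fin N ⊕ Fin m) → k}
    (hf : f ∈ supported k (IsBiclique (Avoids e)) n) :
    toLam k e f ∈ bigraded k P n Finset.univ := by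
  rw [mem_bigraded_iff k e]
  intro S hS
  rw [repr_toLam] at hS
  split_ifs at hS with h
  · refine ⟨?_, h⟩
    simpa [Finset.card_disjSum] using (hf _ hS).2
  · exact absurd rfl hS

theorem exists_toLam_eq {n : ℕ} {y : Lam k P} (hy : y ∈ bigraded k P n Finset.univ) :
    ∃ f ∈ supported k (IsBiclique (Avoids e)) n, toLam k e f = y := by
  rw [mem_bigraded_iff k e] at hy
  -- Extension by zero from the faces with empty right part, where the biclique condition is
  -- vacuous.
  refine ⟨fun s => if s.toRight = ∅ then (lamBasis k e).repr y s.toLeft else 0, ?_, ?_⟩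
  · intro s hs
    simp only at hs
    split_ifs at hs with h
    · refine ⟨fun a b _ hb => ?_, ?_⟩
      · rw [← Finset.mem_toRight, h] at hb
        simp at hb
      · rw [← (hy _ hs).1, ← Finset.card_toLeft_add_card_toRight (u := s), h]
        simp
    · exact absurd rfl hs
  · apply (lamBasis k e).repr.injective
    ext S
    rw [repr_toLam]
    by_cases h : unionOf e S = Finset.univ
    · simp only [h, Finset.toRight_disjSum, Finset.toLeft_disjSum, if_true]
    · rw [if_neg h]
      by_contra h0
      exact h (hy S (Ne.symm h0)).2

theorem toLam_eq_zero {n : ℤ} {f : Finset (Fin N ⊕ Fin m) → k}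
    (hf : f ∈ supported k (IsRightCone (Avoids e)) n) : toLam k e f = 0 := by
  rw [toLam_apply]
  refine Finset.sum_eq_zero fun S _ => ?_
  rw [ite_smul, zero_smul, ite_eq_right_iff]
  intro h
  by_cases h0 : f (S.disjSum ∅) = 0
  · rw [h0, zero_smul]
  · obtain ⟨v, hv⟩ := (hf _ h0).1.2
    obtain ⟨j, hj, hjv⟩ := (unionOf_eq_univ_iff e S).mp h v
    exact absurd (hv j (by simpa using hj)) hjv

/-- A biclique whose left part covers [m] has empty right part, so the value of f there is a
coefficient of `toLam k e f`. With `toLam_eq_zero` this identifies the kernel of `toLam` on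
bicliques as the right cones. -/
theorem mem_supported_of_toLam_eq_zero {n : ℤ} {f : Finset (Fin N ⊕ Fin m) → k}
    (hf : f ∈ supported k (IsBiclique (Avoids e)) n) (h0 : toLam k e f = 0) :
    f ∈ supported k (IsRightCone (Avoids e)) n := by
  intro s hs
  refine ⟨⟨(hf s hs).1, ?_⟩, (hf s hs).2⟩
  by_contra hcon
  push Not at hcon
  have h1 : unionOf e s.toLeft = Finset.univ := by
    rw [unionOf_eq_univ_iff]
    simpa using hcon
  have h2 : s.toRight = ∅ := by
    rw [Finset.eq_empty_iff_forall_notMem]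
    intro v hv
    obtain ⟨j, hj, hjv⟩ := hcon v
    exact hjv ((hf s hs).1 j v hj (Finset.mem_toRight.mp hv))
  have h3 := repr_toLam k e f s.toLeft
  rw [h0, if_pos h1, ← h2, Finset.toLeft_disjSum_toRight] at h3
  exact hs (by simpa using h3.symm)

/-- Over a left part that covers [m] no right vertex can be added to a biclique, so only the left
terms of the boundary survive; the terms of d that lose part of the union are removed by δ. -/
theorem differential_toLam {n : ℤ} {f : Finset (Fin N ⊕ Fin m) → k}
    (hf : f ∈ supported k (IsBiclique (Avoids e)) n) :
    differential k P (toLam k e f) = toLam k e (boundary (sumSign k) f) := by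
  have hbd : ∀ S, unionOf e S = Finset.univ → boundary (sumSign k) f (S.disjSum ∅) =
      ∑ a ∈ Sᶜ, (-1 : k) ^ (S.filter (· < a)).card * f ((insert a S).disjSum ∅) := by
    intro S hS
    rw [boundary_disjSum, add_eq_left.mpr]
    · simp only [sumSign, Finset.toLeft_disjSum]
    · refine Finset.sum_eq_zero fun v _ => ?_
      rw [mul_eq_zero_of_right]
      by_contra h0
      obtain ⟨j, hj, hjv⟩ := (unionOf_eq_univ_iff e S).mp hS v
      exact hjv ((hf _ h0).1 j v (by simpa using hj) (by simp))
  have hL : differential k P (toLam k e f) = ∑ S : Finset (Fin N), ∑ a ∈ S,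
      (if unionOf e (S.erase a) = Finset.univ then
        ((-1 : k) ^ ((S.erase a).filter (· < a)).card * f (S.disjSum ∅)) else 0) •
          lamBasis k e (S.erase a) := by
    rw [toLam_apply, map_sum]
    refine Finset.sum_congr rfl fun S _ => ?_
    rw [map_smul, differential_lamBasis, Finset.smul_sum]
    refine Finset.sum_congr rfl fun a _ => ?_
    have hsub : unionOf e (S.erase a) ⊆ unionOf e S :=
      Finset.biUnion_subset_biUnion_of_subset_left _ (Finset.erase_subset _ _)
    by_cases h1 : unionOf e (S.erase a) = Finset.univ
    · have h2 : unionOf e S = Finset.univ := Finset.univ_subset_iff.mp (h1 ▸ hsub)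
      rw [if_pos h2, if_pos (h2.trans h1.symm), if_pos h1, smul_smul, mul_comm]
    · rw [if_neg h1, zero_smul]
      by_cases h2 : unionOf e S = Finset.univ
      · rw [if_pos h2, if_neg (fun h => h1 (h.symm.trans h2)), smul_zero, smul_zero]
      · rw [if_neg h2, zero_smul]
  have hR : toLam k e (boundary (sumSign k) f) = ∑ S : Finset (Fin N), ∑ a ∈ Sᶜ,
      (if unionOf e S = Finset.univ then
        ((-1 : k) ^ (S.filter (· < a)).card * f ((insert a S).disjSum ∅)) else 0) •
          lamBasis k e S := by
    rw [toLam_apply]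
    refine Finset.sum_congr rfl fun S _ => ?_
    split_ifs with h
    · rw [hbd S h, Finset.sum_smul]
    · simp
  rw [hL, hR, Finset.sum_sigma', Finset.sum_sigma']
  -- A set with a marked element corresponds to the smaller set with a marked element outside it.
  refine Finset.sum_bij' (fun x _ => ⟨x.1.erase x.2, x.2⟩) (fun x _ => ⟨insert x.2 x.1, x.2⟩)
    ?_ ?_ ?_ ?_ ?_
  · rintro ⟨S, a⟩ h; simp
  · rintro ⟨S, a⟩ h; simp
  · rintro ⟨S, a⟩ h
    simp only [Finset.mem_sigma, Finset.mem_univ, true_and] at h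
    simp [Finset.insert_erase h]
  · rintro ⟨S, a⟩ h
    simp only [Finset.mem_sigma, Finset.mem_univ, true_and, Finset.mem_compl] at h
    simp [Finset.erase_insert h]
  · rintro ⟨S, a⟩ h
    simp only [Finset.mem_sigma, Finset.mem_univ, true_and] at h
    simp [Finset.insert_erase h]

end Monomials

/-! ### Simplicial cochains of K as the quotient by left cones. -/

section Cochains

variable (k : Type*) [CommRing k] {m : ℕ} (K : PreAbstractSimplicialComplex (Fin m))
  {P : Set (Finset (Fin m))} {N : ℕ} (e : Fin N ≃ P)

theorem exists_missingFace_subset {σ : Finset (Fin m)} (hσ : ¬ IsSimplex K σ) :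
    ∃ τ ∈ missingFaces K, τ ⊆ σ := by
  induction σ using Finset.strongInduction with
  | H σ ih =>
    by_cases h : ∀ ρ, ρ ⊂ σ → IsSimplex K ρ
    · exact ⟨σ, ⟨hσ, h⟩, subset_rfl⟩
    · push Not at h
      obtain ⟨ρ, hρ, hn⟩ := h
      obtain ⟨τ, hτ, hsub⟩ := ih ρ hρ hn
      exact ⟨τ, hτ, hsub.trans hρ.1⟩

/-- Every non-simplex contains a missing face, which lies in `P`. The defining properties of a
simplicial complement enter only here. -/
theorem IsSimplicialComplement.isSimplex_iff {K : PreAbstractSimplicialComplex (Fin m)}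
    (hP : IsSimplicialComplement K P) (σ : Finset (Fin m)) :
    IsSimplex K σ ↔ ∀ j, ¬ (e j : Finset (Fin m)) ⊆ σ := by
  constructor
  · intro h j hj
    exact hP.1 (e j).2 (h.mono hj)
  · intro h
    by_contra hσ
    obtain ⟨τ, hτ, hsub⟩ := exists_missingFace_subset K hσ
    exact h (e.symm ⟨τ, hP.2 hτ⟩) (by simpa using hsub)

/-- The cochain whose value on `σ` is the value of a function on the complementary set of `σ`. -/
def toCochain (N : ℕ) (q : ℤ) : (Finset (Fin N ⊕ Fin m) → k) →ₗ[k] (Simplices K q → k) where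
  toFun f σ := f ((∅ : Finset (Fin N)).disjSum σ.1ᶜ)
  map_add' _ _ := rfl
  map_smul' _ _ := rfl

theorem toCochain_apply (q : ℤ) (f : Finset (Fin N ⊕ Fin m) → k) (σ : Simplices K q) :
    toCochain k K N q f σ = f ((∅ : Finset (Fin N)).disjSum σ.1ᶜ) := rfl

variable {K}

theorem subset_iff_forall_avoids (σ : Finset (Fin m)) (j : Fin N) :
    (e j : Finset (Fin m)) ⊆ σ ↔ ∀ v ∈ σᶜ, Avoids e j v := by
  simp only [Avoids, Finset.mem_compl]
  exact ⟨fun h v hv hj => hv (h hj), fun h v hj => by_contra fun hv => h v hv hj⟩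

/-- Deleting v from σ is inserting v into σᶜ, and the sign on the right part counts the vertices of
σ below v. A left term would need a member of `P` disjoint from σᶜ, that is, contained in the
simplex σ. -/
theorem coboundary_toCochain (hP : IsSimplicialComplement K P) {n : ℤ}
    {f : Finset (Fin N ⊕ Fin m) → k} (hf : f ∈ supported k (IsBiclique (Avoids e)) n) (q : ℤ) :
    coboundary k K q (toCochain k K N q f) =
      toCochain k K N (q + 1) (boundary (sumSign k) f) := by
  funext σ
  refine Eq.trans ?_ ((boundary_disjSum _ _ _ _).trans (add_eq_right.mpr ?_)).symm
  · rw [compl_compl, ← Finset.sum_coe_sort]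
    refine Finset.sum_congr rfl fun v _ => ?_
    simp only [sumSign, Finset.toLeft_disjSum, Finset.toRight_disjSum, compl_compl,
      Finset.card_empty, pow_zero, one_mul, ← Finset.compl_erase]
    rfl
  · refine Finset.sum_eq_zero fun j _ => ?_
    rw [mul_eq_zero_of_right]
    by_contra h0
    refine (hP.isSimplex_iff e σ.1).mp σ.2.1 j ((subset_iff_forall_avoids e _ _).mpr fun v hv => ?_)
    exact (hf _ h0).1 j v (by simp) (by simpa using hv)

theorem exists_toCochain_eq {n q : ℤ} (hn : n + q + 1 = m) (g : Simplices K q → k) :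
    ∃ f ∈ supported k (IsBiclique (Avoids e)) n, toCochain k K N q f = g := by
  classical
  refine ⟨fun s => if h : s.toLeft = ∅ ∧ IsSimplex K s.toRightᶜ ∧
    (s.toRightᶜ.card : ℤ) = q + 1 then g ⟨_, h.2⟩ else 0, ?_, ?_⟩
  · intro s hs
    simp only at hs
    split_ifs at hs with h
    · refine ⟨fun a b ha _ => ?_, ?_⟩
      · rw [← Finset.mem_toLeft, h.1] at ha
        simp at ha
      · have h1 := Finset.card_add_card_compl s.toRight
        have h2 := Finset.card_toLeft_add_card_toRight (u := s)
        rw [h.1, Finset.card_empty] at h2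
        rw [Fintype.card_fin] at h1
        have h3 := h.2.2
        omega
    · exact absurd rfl hs
  · funext σ
    rw [toCochain_apply, dif_pos (by
      simpa only [Finset.toLeft_disjSum, Finset.toRight_disjSum, compl_compl, true_and] using σ.2)]
    congr 1
    exact Subtype.ext (by simp only [Finset.toRight_disjSum, compl_compl])

theorem toCochain_eq_zero (hP : IsSimplicialComplement K P) {n : ℤ} (q : ℤ)
    {f : Finset (Fin N ⊕ Fin m) → k} (hf : f ∈ supported k (IsLeftCone (Avoids e)) n) :
    toCochain k K N q f = 0 := by
  funext σ
  rw [toCochain_apply, Pi.zero_apply]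
  by_contra h0
  obtain ⟨j, hj⟩ := (hf _ h0).1.2
  exact (hP.isSimplex_iff e σ.1).mp σ.2.1 j
    ((subset_iff_forall_avoids e _ _).mpr fun v hv => hj v (by simpa using hv))

/-- Off the left cones a biclique has empty left part, and its right part is the complement of a
simplex; the relation between n and q puts that simplex in degree q, so the cochain records the
value of f. -/
theorem mem_supported_of_toCochain_eq_zero (hP : IsSimplicialComplement K P) {n q : ℤ}
    (hn : n + q + 1 = m) {f : Finset (Fin N ⊕ Fin m) → k}
    (hf : f ∈ supported k (IsBiclique (Avoids e)) n) (h0 : toCochain k K N q f = 0) :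
    f ∈ supported k (IsLeftCone (Avoids e)) n := by
  intro s hs
  refine ⟨⟨(hf s hs).1, ?_⟩, (hf s hs).2⟩
  by_contra hcon
  have h1 : s.toLeft = ∅ := by
    rw [Finset.eq_empty_iff_forall_notMem]
    intro j hj
    exact hcon ⟨j, fun v hv => (hf s hs).1 j v (Finset.mem_toLeft.mp hj) hv⟩
  have h2 : IsSimplex K s.toRightᶜ := by
    rw [hP.isSimplex_iff e]
    intro j hj
    rw [subset_iff_forall_avoids] at hj
    exact hcon ⟨j, fun v hv => hj v (by simpa using hv)⟩
  have h3 : (s.toRightᶜ.card : ℤ) = q + 1 := by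
    have h3 := Finset.card_add_card_compl s.toRight
    have h4 := Finset.card_toLeft_add_card_toRight (u := s)
    rw [h1, Finset.card_empty] at h4
    rw [Fintype.card_fin] at h3
    have h5 := (hf s hs).2
    omega
  have h4 := congrFun h0 ⟨_, h2, h3⟩
  rw [toCochain_apply] at h4
  simp only [compl_compl, ← h1, Finset.toLeft_disjSum_toRight] at h4
  exact hs h4

end Cochains

/-! ### Both homologies agree with that of the biclique complex. -/

section Homology

universe u
variable (k : Type u) [CommRing k] {m : ℕ} {K : PreAbstractSimplicialComplex (Fin m)}
  {P : Set (Finset (Fin m))} {N : ℕ} (e : Fin N ≃ P)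

/-- The homology in degree `n` of the complex of bicliques. -/
abbrev BicliqueHomology (n : ℤ) : Type u :=
  CycleQuotient (boundary (sumSign k)) (supported k (IsBiclique (Avoids e)) (n + 1))
    (supported k (IsBiclique (Avoids e)) n)

theorem boundary_mem_biclique {n : ℤ} {f : Finset (Fin N ⊕ Fin m) → k}
    (hf : f ∈ supported k (IsBiclique (Avoids e)) (n + 1)) :
    boundary (sumSign k) f ∈ supported k (IsBiclique (Avoids e)) n :=
  boundary_mem (IsBiclique.anti (R := Avoids e)) _ hf

theorem boundary_mem_biclique_sub_one {n : ℤ} {f : Finset (Fin N ⊕ Fin m) → k}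
    (hf : f ∈ supported k (IsBiclique (Avoids e)) n) :
    boundary (sumSign k) f ∈ supported k (IsBiclique (Avoids e)) (n - 1) :=
  boundary_mem_biclique k e (by rwa [sub_add_cancel])

theorem boundary_boundary_sumSign (f : Finset (Fin N ⊕ Fin m) → k) :
    boundary (sumSign k) (boundary (sumSign k) f) = 0 :=
  boundary_boundary (isSignSystem_sumSign k) f

theorem lamComplex_homology (i : ℕ) :
    Nonempty ((lamComplex k P Finset.univ).homology i ≃ₗ[k] BicliqueHomology k e i) := by
  let C := lamComplex k P Finset.univ
  obtain ⟨l, hl, hg⟩ : ∃ l, (ComplexShape.down ℕ).next i = l ∧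
      ∀ x : C.X i, C.d i l x = 0 ↔ differential k P x.1 = 0 := by
    cases i with
    | zero =>
      -- In degree 0 the successor index is 0 itself and the outgoing map is 0. `differential`
      -- vanishes there too, as the boundary would live on faces with -1 elements.
      refine ⟨0, by simp, fun x => ?_⟩
      rw [C.shape 0 0 (by simp)]
      refine iff_of_true rfl ?_
      obtain ⟨f, hf, hfx⟩ := exists_toLam_eq k e (n := 0) x.2
      rw [← hfx, differential_toLam k e hf]
      have h := boundary_mem_biclique_sub_one k e hf
      have h0 : boundary (sumSign k) f = 0 := by
        funext s
        by_contra hs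
        have := (h s hs).2
        simp at this
      rw [h0, map_zero]
    | succ l =>
      refine ⟨l, by simp, fun x => ?_⟩
      simp only [C, lamComplex, ChainComplex.of_d]
      exact Subtype.ext_iff
  obtain ⟨φ⟩ := homology_iso_of_acyclic_kernel (C.sc' (i + 1) i l) (boundary (sumSign k))
    (supported k (IsBiclique (Avoids e)) ((i : ℤ) + 1)) (supported k (IsBiclique (Avoids e)) i)
    (fun y hy => boundary_mem_biclique k e hy) (boundary_boundary_sumSign k)
    (fun y => (⟨toLam k e y, toLam_mem k e (n := i + 1) y.2⟩ : bigraded k P (i + 1) Finset.univ))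
    (((toLam k e).domRestrict _).codRestrict (bigraded k P i Finset.univ)
      fun x => toLam_mem k e x.2)
    (fun y => by
      simp only [C, lamComplex, HomologicalComplex.shortComplexFunctor'_obj_f, ChainComplex.of_d]
      exact Subtype.ext (differential_toLam k e y.2))
    (fun y => by
      obtain ⟨f, hf, hfy⟩ := exists_toLam_eq k e (n := i + 1) y.2
      exact ⟨⟨f, hf⟩, Subtype.ext hfy⟩)
    (fun y => by
      obtain ⟨f, hf, hfy⟩ := exists_toLam_eq k e (n := i) y.2
      exact ⟨⟨f, hf⟩, Subtype.ext hfy⟩)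
    (fun x hx => by
      refine (hg _).mpr ?_
      change differential k P (toLam k e x) = 0
      rw [differential_toLam k e x.2, hx, map_zero])
    (fun x hx => by
      have h1 : differential k P (toLam k e x) = 0 := (hg _).mp hx
      rw [differential_toLam k e x.2] at h1
      -- The boundary of x maps to 0, so it is a cycle on right cones and bounds a chain of right
      -- cones.
      obtain ⟨u, hu, hdu⟩ := exists_boundary_eq_isRightCone (isSignSystem_sumSign k) _ _ _
        (mem_supported_of_toLam_eq_zero k e (boundary_mem_biclique_sub_one k e x.2) h1)
        (boundary_boundary_sumSign k _)
      rw [sub_add_cancel] at hu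
      exact ⟨⟨u, supported_mono (fun s hs => hs.1) _ hu⟩, Subtype.ext (toLam_eq_zero k e hu), hdu⟩)
    (fun x hx hdx => by
      have h1 : toLam k e x = 0 := congrArg Subtype.val hx
      obtain ⟨u, hu, hdu⟩ := exists_boundary_eq_isRightCone (isSignSystem_sumSign k) _ _ _
        (mem_supported_of_toLam_eq_zero k e x.2 h1) hdx
      exact ⟨u, supported_mono (fun s hs => hs.1) _ hu, hdu⟩)
  exact ⟨(C.homologyIsoSc' (i + 1) i l (by simp) hl).toLinearEquiv ≪≫ₗ φ⟩

theorem reducedCohomology_linearEquiv (hP : IsSimplicialComplement K P) {n q : ℤ}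
    (hn : n + q + 1 = m) :
    Nonempty (reducedCohomology k K q ≃ₗ[k] BicliqueHomology k e n) := by
  -- The incoming coboundary starts in degree p, matching faces with n + 1 elements.
  obtain ⟨p, rfl⟩ : ∃ p, q = p + 1 := ⟨q - 1, by omega⟩
  let C := reducedCochainComplex k K
  have hd : ∀ q, C.d q (q + 1) = ModuleCat.ofHom (coboundary k K q) := fun q => by
    simp only [C, reducedCochainComplex, CochainComplex.of_d]
  obtain ⟨φ⟩ := homology_iso_of_acyclic_kernel (C.sc' p (p + 1) (p + 1 + 1))
    (boundary (sumSign k))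
    (supported k (IsBiclique (Avoids e)) (n + 1)) (supported k (IsBiclique (Avoids e)) n)
    (fun y hy => boundary_mem_biclique k e hy) (boundary_boundary_sumSign k)
    (fun y => toCochain k K N p y)
    ((toCochain k K N (p + 1)).domRestrict _)
    (fun y => by
      simp only [HomologicalComplex.shortComplexFunctor'_obj_f, hd]
      exact coboundary_toCochain k e hP y.2 p)
    (fun y => by
      obtain ⟨f, hf, hfy⟩ := exists_toCochain_eq k e (n := n + 1) (q := p) (by omega) y
      exact ⟨⟨f, hf⟩, hfy⟩)
    (fun y => by
      obtain ⟨f, hf, hfy⟩ := exists_toCochain_eq k e hn y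
      exact ⟨⟨f, hf⟩, hfy⟩)
    (fun x hx => by
      simp only [HomologicalComplex.shortComplexFunctor'_obj_g, hd]
      refine (coboundary_toCochain k e hP x.2 (p + 1)).trans ?_
      rw [hx, map_zero]
      rfl)
    (fun x hx => by
      simp only [HomologicalComplex.shortComplexFunctor'_obj_g, hd] at hx
      have h1 := (coboundary_toCochain k e hP x.2 (p + 1)).symm.trans hx
      obtain ⟨u, hu, hdu⟩ := exists_boundary_eq_isLeftCone (isSignSystem_sumSign k) _ _ _
        (mem_supported_of_toCochain_eq_zero k e hP (by omega)
          (boundary_mem_biclique_sub_one k e x.2) h1)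
        (boundary_boundary_sumSign k _)
      rw [sub_add_cancel] at hu
      exact ⟨⟨u, supported_mono (fun s hs => hs.1) _ hu⟩, toCochain_eq_zero k e hP _ hu, hdu⟩)
    (fun x hx hdx => by
      obtain ⟨u, hu, hdu⟩ := exists_boundary_eq_isLeftCone (isSignSystem_sumSign k) _ _ _
        (mem_supported_of_toCochain_eq_zero k e hP hn x.2 hx) hdx
      exact ⟨u, supported_mono (fun s hs => hs.1) _ hu, hdu⟩)
  exact ⟨(C.homologyIsoSc' p (p + 1) (p + 1 + 1) (by simp) (by simp)).toLinearEquiv ≪≫ₗ φ⟩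

end Homology

end

end SimplicialComplement

theorem theorem1p4 {k : Type*} [CommRing k] (hk : IsField k ∨ Nonempty (k ≃+* ℤ))
    {m : ℕ} (K : PreAbstractSimplicialComplex (Fin m))
    (P : Set (Finset (Fin m))) (hP : SimplicialComplement.IsSimplicialComplement K P) (i : ℕ) :
    Nonempty ((SimplicialComplement.lamComplex k P Finset.univ).homology i ≅
      SimplicialComplement.reducedCohomology k K ((m : ℤ) - i - 1)) := by
  -- `P` is finite as a set of subsets of [m]; the enumeration orders the factors of the basis
  -- monomials.
  let e := (Finite.equivFin P).symm
  obtain ⟨φ⟩ := SimplicialComplement.lamComplex_homology k e i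
  obtain ⟨ψ⟩ := SimplicialComplement.reducedCohomology_linearEquiv k e hP
    (n := i) (q := (m : ℤ) - i - 1) (by ring)
  exact ⟨(φ.trans ψ.symm).toModuleIso⟩
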